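/- Let $M>0$ and let $C^1([-M,M])$ be the algebra of restrictions to $[-M,M]$ of continuously differentiable functions $\mathbb{R}\to\mathbb{C}$. Let $(\mathcal{A},\varphi,\rho)$ with $\mathcal{A}=C^1([-M,M])$ be an analytic second-order non-commutative probability space. That is, $\varphi:\mathcal{A}\to\mathbb{C}$ is a unital tracial linear functional; $\rho:\mathcal{A}\times\mathcal{A}\to\mathbb{C}$ is bilinear, tracial in both arguments, with $\rho(1,a)=\rho(a,1)=0$ for all $a\in\mathcal{A}$; there is a probability measure $\mu$ on $[-M,M]$ with $\varphi(f)=\int f\,d\mu$ for all $f\in\mathcal{A}$; and there is a function $u:[-M,M]^2\to\mathbb{R}$ of bounded Fréchet variation such that, for all $f,g\in\mathcal{A}$, $$\rho(f,g)=\int_{-M}^{M}\int_{-M}^{M} f'(x)\,g'(y)\,du(x,y).$$ Here, with $\Delta u(s,s';t,t')=u(s',t')-u(s',t)-u(s,t')+u(s,t)$, bounded Fréchet variation means that the sums $\sum_{i,j}\sigma_i\theta_j\,\Delta u(s_{i-1},s_i;t_{j-1},t_j)$ are bounded uniformly over all partitions $(s_i)$, $(t_j)$ of $[-M,M]$ and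 all signs $\sigma_i,\theta_j\in\{\pm1\}$; and the Fréchet integral $\int\int h(x)k(y)\,du(x,y)$ is the limit of the sums $\sum_{i,j}h(\xi_i)k(\eta_j)\,\Delta u(s_{i-1},s_i;t_{j-1},t_j)$, with $\xi_i\in[s_{i-1},s_i]$ and $\eta_j\in[t_{j-1},t_j]$, as the meshes of both partitions tend to $0$. For $z,w\in\mathbb{C}\setminus[-M,M]$ let $r_z(x)=\frac{1}{z-x}$ and let $G_2(z,w)=\rho(r_z,r_w)$ be the second-order Cauchy transform. Suppose that $f,g\in C^1([-M,M])$ extend to analytic functions, again denoted $f,g$, on a domain $\Omega\subset\mathbb{C}$ with $[-M,M]\subset\Omega$. Let $\mathcal{C}$ be a positively oriented, piecewise continuously differentiable, simple closed contour which encloses $[-M,M]$ (that is, $[-M,M]$ lies in the interior of $\mathcal{C}$) and which is contained, together with its interior, in $\Omega$. Then the iterated contour integral below exists and $$\rho(f,g)=\frac{1}{(2\pi i)^2}\int_{\mathcal{C}}\int_{\mathcal{C}} f(z)\,g(w)\,G_2(z,w)\,dz\,dw.$$ -/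

import Mathlib

noncomputable section

open Set MeasureTheory

/-- A second-order non-commutative probability space `(A, φ, ρ)` over a unital complex
algebra `A`: a unital tracial linear functional `φ`, and a bilinear functional `ρ` that is
tracial in both arguments and vanishes as soon as one argument is `1`. -/
structure SecondOrderNCPS (A : Type*) [Ring A] [Algebra ℂ A] where
  φ : A →ₗ[ℂ] ℂ
  ρ : A →ₗ[ℂ] A →ₗ[ℂ] ℂ
  φ_one : φ 1 = 1
  φ_tracial : ∀ a b, φ (a * b) = φ (b * a)
  ρ_tracial_left : ∀ a b c, ρ (a * b) c = ρ (b * a) c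
  ρ_tracial_right : ∀ a b c, ρ a (b * c) = ρ a (c * b)
  ρ_one_left : ∀ a, ρ 1 a = 0
  ρ_one_right : ∀ a, ρ a 1 = 0

/-- `C¹([-M, M])`: the algebra of the restrictions to `[-M, M]` of the continuously
differentiable functions `ℝ → ℂ`. -/
def C1 (M : ℝ) : Subalgebra ℂ (Icc (-M) M → ℂ) where
  carrier := {f | ∃ F : ℝ → ℂ, ContDiff ℝ 1 F ∧ ∀ x : Icc (-M) M, F x = f x}
  mul_mem' := by
    rintro f g ⟨F, hF, hf⟩ ⟨G, hG, hg⟩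
    exact ⟨fun x => F x * G x, hF.mul hG, fun x => by simp [hf, hg]⟩
  add_mem' := by
    rintro f g ⟨F, hF, hf⟩ ⟨G, hG, hg⟩
    exact ⟨fun x => F x + G x, hF.add hG, fun x => by simp [hf, hg]⟩
  algebraMap_mem' := fun c => ⟨fun _ => c, contDiff_const, fun _ => rfl⟩

/-- The derivative `f'` of `f ∈ C¹([-M, M])` (one-sided at `±M`); only its values on `[-M, M]`
are meaningful. -/
def C1.derivative {M : ℝ} (f : C1 M) : ℝ → ℂ :=
  derivWithin (Function.extend Subtype.val f.1 0) (Icc (-M) M)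

theorem C1.derivative_eq {M : ℝ} (hM : 0 < M) (f : C1 M) (F : ℝ → ℂ) (hF : ContDiff ℝ 1 F)
    (h : ∀ x : Icc (-M) M, F x = f.1 x) (x : ℝ) (hx : x ∈ Icc (-M) M) :
    C1.derivative f x = deriv F x := by
  have key : ∀ y ∈ Icc (-M) M, Function.extend Subtype.val f.1 0 y = F y := fun y hy => by
    rw [h ⟨y, hy⟩]
    exact Subtype.val_injective.extend_apply f.1 0 ⟨y, hy⟩
  unfold C1.derivative
  rw [derivWithin_congr key (key x hx)]
  exact ((hF.differentiable one_ne_zero) x).derivWithin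
    (uniqueDiffOn_Icc (by linarith) x hx)

/-- `s 0 ≤ s 1 ≤ ⋯ ≤ s m` is a partition of `[-M, M]`. -/
def IsPartition (M : ℝ) (m : ℕ) (s : ℕ → ℝ) : Prop :=
  s 0 = -M ∧ s m = M ∧ ∀ i < m, s i ≤ s (i + 1)

/-- The increment `Δu (s₀, s₁; t₀, t₁)`. -/
def rectIncr (u : ℝ → ℝ → ℝ) (s₀ s₁ t₀ t₁ : ℝ) : ℝ :=
  u s₁ t₁ - u s₁ t₀ - u s₀ t₁ + u s₀ t₀

/-- `u` has bounded Fréchet variation on `[-M, M]²`. Only the values of `u` on the square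
matter. -/
def BoundedFrechetVariation (M : ℝ) (u : ℝ → ℝ → ℝ) : Prop :=
  ∃ B : ℝ, ∀ (m n : ℕ) (s t σ θ : ℕ → ℝ), IsPartition M m s → IsPartition M n t →
    (∀ i, σ i = 1 ∨ σ i = -1) → (∀ j, θ j = 1 ∨ θ j = -1) →
    |∑ i ∈ Finset.range m, ∑ j ∈ Finset.range n,
      σ i * θ j * rectIncr u (s i) (s (i + 1)) (t j) (t (j + 1))| ≤ B

/-- The Fréchet integral `∫∫ f(x) g(y) du(x,y)` over `[-M, M]²` exists and equals `I`: the
Riemann sums converge to `I` as the meshes of both partitions tend to zero, uniformly in the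
choice of the tags. -/
def HasFrechetIntegral (M : ℝ) (u : ℝ → ℝ → ℝ) (f g : ℝ → ℂ) (I : ℂ) : Prop :=
  ∀ ε > 0, ∃ δ > 0, ∀ (m n : ℕ) (s t ξ η : ℕ → ℝ), IsPartition M m s → IsPartition M n t →
    (∀ i < m, s (i + 1) - s i < δ) → (∀ j < n, t (j + 1) - t j < δ) →
    (∀ i < m, ξ i ∈ Icc (s i) (s (i + 1))) → (∀ j < n, η j ∈ Icc (t j) (t (j + 1))) →
    ‖(∑ i ∈ Finset.range m, ∑ j ∈ Finset.range n,
      f (ξ i) * g (η j) * (rectIncr u (s i) (s (i + 1)) (t j) (t (j + 1)) : ℂ)) - I‖ < ε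

/-- A second-order non-commutative probability space on `C¹([-M, M])` is analytic if `φ` is the
integral against a probability measure on `[-M, M]` and `ρ(f, g) = ∫∫ f'(x) g'(y) du(x,y)` as a
Fréchet integral, for some `u` of bounded Fréchet variation. -/
def SecondOrderNCPS.IsAnalytic {M : ℝ} (S : SecondOrderNCPS (C1 M)) : Prop :=
  (∃ μ : Measure (Icc (-M) M), IsProbabilityMeasure μ ∧
    ∀ f : C1 M, S.φ f = ∫ x, f.1 x ∂μ) ∧
  ∃ u : ℝ → ℝ → ℝ, BoundedFrechetVariation M u ∧
    ∀ f g : C1 M, HasFrechetIntegral M u (C1.derivative f) (C1.derivative g) (S.ρ f g)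

/-- The interval `[-M, M]` as a subset of `ℂ`. -/
def realSegment (M : ℝ) : Set ℂ := (fun x : ℝ => (x : ℂ)) '' Icc (-M) M

theorem resolvent_mem_C1 {M : ℝ} {z : ℂ} (hz : z ∉ realSegment M) :
    (fun x : Icc (-M) M => 1 / (z - ((x : ℝ) : ℂ))) ∈ C1 M := by
  have smooth : ∀ x : ℝ, z ≠ (x : ℂ) →
      ContDiffAt ℝ 1 (fun x : ℝ => 1 / (z - (x : ℂ))) x := fun x hx => by
    have h : ContDiffAt ℝ 1 (fun x : ℝ => z - (x : ℂ)) x :=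
      contDiffAt_const.sub Complex.ofRealCLM.contDiff.contDiffAt
    simp only [one_div]
    exact h.inv (sub_ne_zero.2 hx)
  by_cases him : ∃ x₀ : ℝ, z = (x₀ : ℂ)
  · obtain ⟨x₀, rfl⟩ := him
    have hx₀ : x₀ ∉ Icc (-M) M := fun h => hz ⟨x₀, h, rfl⟩
    by_cases hM : M < 0
    · exact ⟨0, contDiff_const, fun x => by
        have h1 := x.2.1
        have h2 := x.2.2
        linarith⟩
    have hlt : M < |x₀| := by
      by_contra hcon
      exact hx₀ (abs_le.1 (not_lt.1 hcon))
    let b : ContDiffBump (0 : ℝ) :=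
      ⟨(2 * M + |x₀|) / 3, (M + 2 * |x₀|) / 3, by linarith, by linarith⟩
    refine ⟨fun x => (b x : ℂ) * (1 / ((x₀ : ℂ) - (x : ℂ))), ?_, ?_⟩
    · rw [contDiff_iff_contDiffAt]
      intro x
      have hb : ContDiffAt ℝ 1 (fun x : ℝ => (b x : ℂ)) x :=
        (Complex.ofRealCLM.contDiff.comp b.contDiff).contDiffAt
      by_cases hx : x = x₀
      · have : (fun x : ℝ => (b x : ℂ) * (1 / ((x₀ : ℂ) - (x : ℂ)))) =ᶠ[nhds x]
            fun _ => (0 : ℂ) := by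
          have hopen : IsOpen {y : ℝ | (M + 2 * |x₀|) / 3 < |y|} :=
            isOpen_lt continuous_const continuous_abs
          filter_upwards [hopen.mem_nhds (show (M + 2 * |x₀|) / 3 < |x| by
            rw [hx]; linarith)] with y hy
          have : b y = 0 := b.zero_of_le_dist (by
            rw [Real.dist_eq, sub_zero]; exact le_of_lt hy)
          simp [this]
        exact contDiffAt_const.congr_of_eventuallyEq this
      · exact hb.mul (smooth x fun h => hx (Complex.ofReal_injective h).symm)
    · intro x
      have : b x = 1 := b.one_of_mem_closedBall (by
        rw [Metric.mem_closedBall, Real.dist_eq, sub_zero]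
        have := abs_le.2 x.2
        change |(x : ℝ)| ≤ (2 * M + |x₀|) / 3
        linarith)
      simp [this]
  · exact ⟨fun x => 1 / (z - (x : ℂ)),
      contDiff_iff_contDiffAt.2 fun x => smooth x fun h => him ⟨x, h⟩, fun _ => rfl⟩

open Classical in
/-- The resolvent function `r_z(x) = 1 / (z - x)` in `C¹([-M, M])`, for `z ∉ [-M, M]`
(and the dummy value `0` for `z ∈ [-M, M]`). -/
def resolventC1 (M : ℝ) (z : ℂ) : C1 M :=
  if hz : z ∉ realSegment M then ⟨fun x => 1 / (z - ((x : ℝ) : ℂ)), resolvent_mem_C1 hz⟩ else 0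

/-- The second-order Cauchy transform `G₂(z, w) = ρ(r_z, r_w)` on `(ℂ ∖ [-M, M])²`. -/
def SecondOrderNCPS.G₂ {M : ℝ} (S : SecondOrderNCPS (C1 M)) (z w : ℂ) : ℂ :=
  S.ρ (resolventC1 M z) (resolventC1 M w)

/-- `γ : [a, b] → ℂ` is a simple closed contour: piecewise continuously differentiable, closed,
and without other self-intersections. -/
structure IsSimpleClosedContour (γ : ℝ → ℂ) (a b : ℝ) : Prop where
  lt : a < b
  piecewise : ∃ (n : ℕ) (p : ℕ → ℝ), p 0 = a ∧ p n = b ∧ (∀ i < n, p i < p (i + 1)) ∧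
    ∀ i < n, ContDiffOn ℝ 1 γ (Icc (p i) (p (i + 1)))
  closed : γ a = γ b
  simple : InjOn γ (Ico a b)

/-- The contour integral `∮ F(z) dz = ∫ₐᵇ F(γ(t)) γ'(t) dt`. -/
def contourIntegral (γ : ℝ → ℂ) (a b : ℝ) (F : ℂ → ℂ) : ℂ :=
  ∫ t in a..b, F (γ t) * deriv γ t

/-- Existence of the contour integral `∮ F(z) dz`. -/
def ContourIntegrable (γ : ℝ → ℂ) (a b : ℝ) (F : ℂ → ℂ) : Prop :=
  IntervalIntegrable (fun t => F (γ t) * deriv γ t) volume a b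

/-- The interior of a closed contour: the points off the contour whose connected component in
the complement of the contour is bounded. -/
def contourInterior (γ : ℝ → ℂ) (a b : ℝ) : Set ℂ :=
  {z | z ∉ γ '' Icc a b ∧ Bornology.IsBounded (connectedComponentIn (γ '' Icc a b)ᶜ z)}

/-- The contour is positively oriented: it winds once counterclockwise around each point of its
interior. -/
def PositivelyOriented (γ : ℝ → ℂ) (a b : ℝ) : Prop :=
  ∀ z ∈ contourInterior γ a b,
    (2 * Real.pi * Complex.I)⁻¹ * contourIntegral γ a b (fun ζ => 1 / (ζ - z)) = 1

end

open Set MeasureTheory Filter Topology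

/-! The functional ρ sees only derivatives. Bounded Fréchet variation bounds the Riemann sums by the
sup norms of the integrands, every continuous function on [-M, M] is the derivative of some element
of C¹, and ρ kills constants. Hence ρ(f, g) = β(f', g') for a bounded bilinear form β on C([-M, M])
(`SecondOrderNCPS.IsAnalytic.exists_bilinear`). In particular G₂(z, w) = β((z - ·)⁻², (w - ·)⁻²),
the sign in r_z' being positive.

Cauchy's formula 2πi f' = ∮ f(z) (z - ·)⁻² dz holds as an identity of Bochner integrals in C([-M,
M]), because the kernel depends continuously on z off the segment. A bounded functional passes
through such an integral (`contourIntegral_mul_resolventDeriv`). Doing this in z with w fixed, and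
then in w, gives both existence and value of the iterated integral, without Fubini.

Cauchy's formula itself (`IsRectifiableLoop.contourIntegral_div_sq`) is obtained by Dixon's
argument. Winding number 1 inside is the orientation hypothesis and winding number 0 outside is
proved, so the Jordan curve theorem is not needed. -/

/-! ### Rectifiable loops and Cauchy transforms -/

/-- A closed continuous curve that is differentiable off a countable set and has an integrable
derivative. -/
structure IsRectifiableLoop (γ : ℝ → ℂ) (a b : ℝ) : Prop where
  lt : a < b
  continuousOn : ContinuousOn γ (Icc a b)
  integrable : IntervalIntegrable (deriv γ) volume a b
  differentiable : ∃ s : Set ℝ, s.Countable ∧ ∀ t ∈ Ioo a b \ s, DifferentiableAt ℝ γ t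
  closed : γ a = γ b

/-- The two-sided `deriv` may be a junk value at the endpoints. These form a null set, and on the
open interval it agrees with the continuous `derivWithin`. -/
theorem intervalIntegrable_deriv_of_contDiffOn {γ : ℝ → ℂ} {c d : ℝ} (h : c < d)
    (hγ : ContDiffOn ℝ 1 γ (Icc c d)) : IntervalIntegrable (deriv γ) volume c d := by
  have hcont : ContinuousOn (derivWithin γ (Icc c d)) (Icc c d) :=
    hγ.continuousOn_derivWithin (uniqueDiffOn_Icc h) le_rfl
  rw [intervalIntegrable_iff_integrableOn_Ioo_of_le h.le]
  refine ((hcont.integrableOn_Icc).mono_set Ioo_subset_Icc_self).congr_fun (fun t ht => ?_)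
    measurableSet_Ioo
  exact derivWithin_of_mem_nhds (Icc_mem_nhds ht.1 ht.2)

theorem IsSimpleClosedContour.isRectifiableLoop {γ : ℝ → ℂ} {a b : ℝ}
    (hγ : IsSimpleClosedContour γ a b) : IsRectifiableLoop γ a b := by
  obtain ⟨n, p, h0, hn, hlt, hC⟩ := hγ.piecewise
  -- The pieces are glued one at a time; the breakpoints `range p` serve as the countable
  -- exceptional set.
  have key : ∀ i ≤ n, p 0 ≤ p i ∧ ContinuousOn γ (Icc (p 0) (p i)) ∧
      IntervalIntegrable (deriv γ) volume (p 0) (p i) ∧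
      ∀ t ∈ Ioo (p 0) (p i) \ range p, DifferentiableAt ℝ γ t := by
    intro i
    induction i with
    | zero => simp
    | succ i ih =>
      intro hi
      obtain ⟨h1, h2, h3, h4⟩ := ih (by omega)
      have hl := hlt i (by omega)
      have hc := hC i (by omega)
      refine ⟨h1.trans hl.le, ?_, h3.trans (intervalIntegrable_deriv_of_contDiffOn hl hc), ?_⟩
      · rw [← Icc_union_Icc_eq_Icc h1 hl.le]
        exact h2.union_of_isClosed hc.continuousOn isClosed_Icc isClosed_Icc
      · rintro t ⟨⟨ht1, ht2⟩, ht3⟩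
        rcases lt_trichotomy t (p i) with h | h | h
        · exact h4 t ⟨⟨ht1, h⟩, ht3⟩
        · exact absurd ⟨i, h.symm⟩ ht3
        · exact (hc.differentiableOn one_ne_zero).differentiableAt (Icc_mem_nhds h ht2)
  obtain ⟨-, h2, h3, h4⟩ := key n le_rfl
  rw [h0, hn] at h2 h3 h4
  exact ⟨hγ.lt, h2, h3, ⟨range p, countable_range p, h4⟩, hγ.closed⟩

/-- Fundamental theorem of calculus for holomorphic primitives along a loop. -/
theorem IsRectifiableLoop.contourIntegral_eq_zero {γ : ℝ → ℂ} {a b : ℝ}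
    (hγ : IsRectifiableLoop γ a b) {P p : ℂ → ℂ}
    (hP : ∀ t ∈ Icc a b, HasDerivAt P (p (γ t)) (γ t))
    (hp : ContinuousOn (fun t => p (γ t)) (Icc a b)) : contourIntegral γ a b p = 0 := by
  obtain ⟨s, hs, hd⟩ := hγ.differentiable
  have h := integral_eq_of_hasDerivAt_off_countable_of_le (fun t => P (γ t))
    (fun t => p (γ t) * deriv γ t) hγ.lt.le hs
    (fun t ht => (hP t ht).continuousAt.comp_continuousWithinAt (hγ.continuousOn t ht))
    (fun t ht => (hP t (Ioo_subset_Icc_self ht.1)).comp_of_eq t (hd t ht).hasDerivAt rfl)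
    (hγ.integrable.continuousOn_mul (by rwa [uIcc_of_le hγ.lt.le]))
  rw [contourIntegral, h, hγ.closed, sub_self]

/-- Differentiation under the integral sign for a bounded holomorphic kernel. -/
theorem hasDerivAt_intervalIntegral_of_holomorphic {K : ℂ → ℝ → ℂ} {d : ℝ → ℂ} {a b : ℝ}
    (hab : a ≤ b) (hd : IntervalIntegrable d volume a b) {z₀ : ℂ} {r C : ℝ} (hr : 0 < r)
    (hK : ∀ t ∈ Icc a b, DifferentiableOn ℂ (fun z => K z t) (Metric.ball z₀ r))
    (hbd : ∀ t ∈ Icc a b, ∀ z ∈ Metric.ball z₀ r, ‖K z t‖ ≤ C)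
    (hcont : ∀ z ∈ Metric.ball z₀ r, ContinuousOn (K z) (Icc a b)) :
    HasDerivAt (fun z => ∫ t in a..b, K z t * d t)
      (∫ t in a..b, deriv (fun z => K z t) z₀ * d t) z₀ := by
  have hsub : uIoc a b ⊆ Icc a b := by
    rw [uIoc_of_le hab]; exact Ioc_subset_Icc_self
  have hmeas : ∀ z ∈ Metric.ball z₀ r,
      AEStronglyMeasurable (K z) (volume.restrict (uIoc a b)) := fun z hz =>
    ((hcont z hz).mono hsub).aestronglyMeasurable measurableSet_uIoc
  have hz₀ : z₀ ∈ Metric.ball z₀ r := Metric.mem_ball_self hr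
  have hdm : AEStronglyMeasurable d (volume.restrict (uIoc a b)) :=
    (intervalIntegrable_iff.1 hd).aestronglyMeasurable
  have hderiv : ∀ t ∈ Icc a b, ∀ z ∈ Metric.ball z₀ r,
      HasDerivAt (fun z => K z t) (deriv (fun z => K z t) z) z := fun t ht z hz =>
    ((hK t ht).differentiableAt (Metric.isOpen_ball.mem_nhds hz)).hasDerivAt
  refine (intervalIntegral.hasDerivAt_integral_of_dominated_loc_of_deriv_le
    (bound := fun t => C / (r / 4) * ‖d t‖)
    (F' := fun z t => deriv (fun z => K z t) z * d t)
    (Metric.ball_mem_nhds z₀ (half_pos hr)) ?_ ?_ ?_ ?_ ?_ ?_).2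
  · filter_upwards [Metric.ball_mem_nhds z₀ hr] with z hz
    exact (hmeas z hz).mul hdm
  · exact hd.continuousOn_mul (by rw [uIcc_of_le hab]; exact hcont z₀ hz₀)
  · refine AEStronglyMeasurable.mul ?_ hdm
    -- The derivative in z is measurable in t as a pointwise limit of difference quotients; the
    -- shift by `N` keeps all their nodes in the ball.
    obtain ⟨v, hv⟩ := exists_seq_tendsto (𝓝[≠] z₀)
    have hv' : Tendsto (fun n => v n) atTop (𝓝 z₀) := hv.mono_right nhdsWithin_le_nhds
    obtain ⟨N, hN⟩ := eventually_atTop.1 (hv'.eventually (Metric.ball_mem_nhds z₀ hr))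
    refine aestronglyMeasurable_of_tendsto_ae atTop
      (f := fun (n : ℕ) (t : ℝ) => (v (n + N) - z₀)⁻¹ * (K (v (n + N)) t - K z₀ t)) (fun n => ?_) ?_
    · exact ((hmeas _ (hN (n + N) (by omega))).sub (hmeas _ hz₀)).const_mul _
    · refine (ae_restrict_iff' measurableSet_uIoc).2 (Eventually.of_forall fun t ht => ?_)
      exact (hasDerivAt_iff_tendsto_slope.1 (hderiv t (hsub ht) z₀ hz₀)).comp
        (hv.comp (tendsto_add_atTop_nat N))
  · refine Eventually.of_forall fun t ht z hz => ?_
    rw [norm_mul]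
    refine mul_le_mul_of_nonneg_right ?_ (norm_nonneg _)
    -- For z within r/2 of z₀ the circle of radius r/4 about z stays in the ball, so Cauchy's
    -- estimate bounds the derivative by C / (r/4).
    have hcl : Metric.closedBall z (r / 4) ⊆ Metric.ball z₀ r := fun y hy => by
      rw [Metric.mem_ball] at *
      rw [Metric.mem_closedBall] at hy
      linarith [dist_triangle y z z₀]
    refine Complex.norm_deriv_le_of_forall_mem_sphere_norm_le (by positivity)
      (((hK t (hsub ht)).mono (by
        rw [closure_ball z (by positivity : r / 4 ≠ 0)]; exact hcl)).diffContOnCl) ?_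
    exact fun y hy => hbd t (hsub ht) y (hcl (Metric.sphere_subset_closedBall hy))
  · exact hd.norm.const_mul _
  · exact Eventually.of_forall fun t ht z hz =>
      (hderiv t (hsub ht) z (Metric.ball_subset_ball (by linarith) hz)).mul_const _

theorem IsRectifiableLoop.isCompact_image {γ : ℝ → ℂ} {a b : ℝ} (hγ : IsRectifiableLoop γ a b) :
    IsCompact (γ '' Icc a b) := isCompact_Icc.image_of_continuousOn hγ.continuousOn

theorem IsRectifiableLoop.contourIntegrable {γ : ℝ → ℂ} {a b : ℝ} (hγ : IsRectifiableLoop γ a b)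
    {F : ℂ → ℂ} (hF : ContinuousOn F (γ '' Icc a b)) : ContourIntegrable γ a b F := by
  refine hγ.integrable.continuousOn_mul ?_
  rw [uIcc_of_le hγ.lt.le]
  exact hF.comp hγ.continuousOn (mapsTo_image _ _)

/-- The Cauchy transform of a continuous function on a loop is differentiable off the loop. -/
theorem IsRectifiableLoop.hasDerivAt_cauchyTransform {γ : ℝ → ℂ} {a b : ℝ}
    (hγ : IsRectifiableLoop γ a b) {F : ℂ → ℂ} (hF : ContinuousOn F (γ '' Icc a b)) {z₀ : ℂ}
    (hz₀ : z₀ ∉ γ '' Icc a b) :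
    HasDerivAt (fun z => contourIntegral γ a b (fun ζ => F ζ / (ζ - z)))
      (contourIntegral γ a b (fun ζ => F ζ / (ζ - z₀) ^ 2)) z₀ := by
  obtain ⟨r, hr, hball⟩ : ∃ r > 0, Metric.ball z₀ r ⊆ (γ '' Icc a b)ᶜ :=
    Metric.isOpen_iff.1 hγ.isCompact_image.isClosed.isOpen_compl z₀ hz₀
  obtain ⟨C, hC⟩ := hγ.isCompact_image.exists_bound_of_continuousOn hF
  have hC0 : 0 ≤ C := (norm_nonneg _).trans (hC (γ a) ⟨a, left_mem_Icc.2 hγ.lt.le, rfl⟩)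
  have hmem : ∀ t ∈ Icc a b, ∀ z ∈ Metric.ball z₀ (r / 2), r / 2 ≤ ‖γ t - z‖ := by
    intro t ht z hz
    have h1 : r ≤ dist (γ t) z₀ := by
      by_contra h
      exact hball (Metric.mem_ball.2 (not_le.1 h)) ⟨t, ht, rfl⟩
    rw [← dist_eq_norm]
    rw [Metric.mem_ball] at hz
    linarith [dist_triangle (γ t) z z₀]
  have hne : ∀ t ∈ Icc a b, ∀ z ∈ Metric.ball z₀ (r / 2), γ t - z ≠ 0 := fun t ht z hz =>
    norm_pos_iff.1 (by linarith [hmem t ht z hz])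
  have hFc : ContinuousOn (fun t => F (γ t)) (Icc a b) :=
    hF.comp hγ.continuousOn (mapsTo_image _ _)
  have hd : ∀ t ∈ Icc a b, ∀ z ∈ Metric.ball z₀ (r / 2),
      HasDerivAt (fun z => F (γ t) / (γ t - z)) (F (γ t) / (γ t - z) ^ 2) z := by
    intro t ht z hz
    simpa [div_eq_mul_inv] using
      (((hasDerivAt_id z).const_sub (γ t)).fun_inv (hne t ht z hz)).const_mul (F (γ t))
  have h := hasDerivAt_intervalIntegral_of_holomorphic (K := fun z t => F (γ t) / (γ t - z))
    hγ.lt.le hγ.integrable (half_pos hr) (C := C / (r / 2))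
    (fun t ht z hz => (hd t ht z hz).differentiableAt.differentiableWithinAt)
    (fun t ht z hz => by
      rw [norm_div]
      exact div_le_div₀ hC0 (hC _ ⟨t, ht, rfl⟩) (half_pos hr) (hmem t ht z hz))
    (fun z hz => hFc.div (hγ.continuousOn.sub continuousOn_const) fun t ht => hne t ht z hz)
  refine h.congr_deriv (intervalIntegral.integral_congr fun t ht => ?_)
  rw [uIcc_of_le hγ.lt.le] at ht
  simp only [(hd t ht z₀ (Metric.mem_ball_self (half_pos hr))).deriv]

/-- If the loop lies in the disc of radius R, the kernel is at most C / (‖z‖ - R) for large z. This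
decay is used for the winding number outside and for Liouville's theorem. -/
theorem IsRectifiableLoop.tendsto_cauchyTransform {γ : ℝ → ℂ} {a b : ℝ}
    (hγ : IsRectifiableLoop γ a b) {F : ℂ → ℂ} (hF : ContinuousOn F (γ '' Icc a b)) :
    Tendsto (fun z => contourIntegral γ a b (fun ζ => F ζ / (ζ - z)))
      (Bornology.cobounded ℂ) (𝓝 0) := by
  obtain ⟨C, hC⟩ := hγ.isCompact_image.exists_bound_of_continuousOn hF
  obtain ⟨R, hR⟩ := hγ.isCompact_image.isBounded.exists_norm_le
  have hC0 : 0 ≤ C := (norm_nonneg _).trans (hC (γ a) ⟨a, left_mem_Icc.2 hγ.lt.le, rfl⟩)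
  have hlim : Tendsto (fun z : ℂ => C * (∫ t in a..b, ‖deriv γ t‖) * (‖z‖ - R)⁻¹)
      (Bornology.cobounded ℂ) (𝓝 0) := by
    have h1 : Tendsto (fun z : ℂ => ‖z‖ - R) (Bornology.cobounded ℂ) atTop :=
      tendsto_atTop_add_const_right _ _ tendsto_norm_cobounded_atTop
    simpa using h1.inv_tendsto_atTop.const_mul (C * ∫ t in a..b, ‖deriv γ t‖)
  refine squeeze_zero_norm' ?_ hlim
  filter_upwards [tendsto_norm_cobounded_atTop.eventually_gt_atTop R] with z hz
  have hb : ∀ᵐ t, t ∈ Ioc a b →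
      ‖F (γ t) / (γ t - z) * deriv γ t‖ ≤ C * (‖z‖ - R)⁻¹ * ‖deriv γ t‖ := by
    refine Eventually.of_forall fun t ht => ?_
    have ht' : γ t ∈ γ '' Icc a b := ⟨t, Ioc_subset_Icc_self ht, rfl⟩
    rw [norm_mul, norm_div, ← div_eq_mul_inv]
    refine mul_le_mul_of_nonneg_right ?_ (norm_nonneg _)
    refine div_le_div₀ hC0 (hC _ ht') (by linarith) ?_
    rw [norm_sub_rev]
    linarith [norm_sub_norm_le z (γ t), hR _ ht']
  refine (intervalIntegral.norm_integral_le_of_norm_le hγ.lt.le hb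
    (hγ.integrable.norm.const_mul _)).trans_eq ?_
  rw [intervalIntegral.integral_const_mul]
  ring

/-! ### Winding numbers outside the loop -/

/-- `∮ dζ / (ζ - z)` vanishes if `z` lies in an unbounded component of the complement. -/
theorem IsRectifiableLoop.contourIntegral_inv_eq_zero {γ : ℝ → ℂ} {a b : ℝ}
    (hγ : IsRectifiableLoop γ a b) {z : ℂ} (hz : z ∉ γ '' Icc a b)
    (hz' : z ∉ contourInterior γ a b) :
    contourIntegral γ a b (fun ζ => 1 / (ζ - z)) = 0 := by
  set V := connectedComponentIn (γ '' Icc a b)ᶜ z with hV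
  have hVsub : V ⊆ (γ '' Icc a b)ᶜ := connectedComponentIn_subset _ _
  have hVo : IsOpen V := hγ.isCompact_image.isClosed.isOpen_compl.connectedComponentIn
  have hVu : ¬ Bornology.IsBounded V := fun h => hz' ⟨hz, h⟩
  have hder : ∀ y ∈ V, HasDerivAt (fun z => contourIntegral γ a b (fun ζ => 1 / (ζ - z))) 0 y := by
    intro y hy
    have hne : ∀ t ∈ Icc a b, γ t - y ≠ 0 := fun t ht h =>
      hVsub hy ⟨t, ht, sub_eq_zero.1 h⟩
    convert hγ.hasDerivAt_cauchyTransform (F := fun _ => 1) continuousOn_const (hVsub hy) using 1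
    -- The integrand (ζ - y)⁻² has the primitive -(ζ - y)⁻¹, so the winding integral is locally
    -- constant.
    refine (hγ.contourIntegral_eq_zero (P := fun ζ => -(ζ - y)⁻¹) (fun t ht => ?_) ?_).symm
    · simpa [neg_div] using (((hasDerivAt_id (γ t)).sub_const y).fun_inv (hne t ht)).fun_neg
    · exact continuousOn_const.div ((hγ.continuousOn.sub continuousOn_const).pow 2)
        fun t ht => pow_ne_zero 2 (hne t ht)
  have hconst : ∀ y ∈ V, contourIntegral γ a b (fun ζ => 1 / (ζ - y)) =
      contourIntegral γ a b (fun ζ => 1 / (ζ - z)) := fun y hy =>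
    hVo.is_const_of_deriv_eq_zero isPreconnected_connectedComponentIn
      (fun y hy => (hder y hy).differentiableAt.differentiableWithinAt)
      (fun y hy => (hder y hy).deriv) hy (mem_connectedComponentIn hz)
  -- A nonzero constant value on V is incompatible with decay at infinity unless V is bounded.
  by_contra hne
  refine hVu (Bornology.isBounded_def.2 ?_)
  filter_upwards [(hγ.tendsto_cauchyTransform (F := fun _ => 1)
    continuousOn_const).eventually_ne (Ne.symm hne)] with y hy hyV
  exact hy (hconst y hyV)

/-- The ray {tz : t ≥ 1} misses the curve, so it lies in the component of z and makes it unbounded.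
-/
theorem notMem_contourInterior_of_norm_gt {γ : ℝ → ℂ} {a b R : ℝ}
    (hR : ∀ t ∈ Icc a b, ‖γ t‖ ≤ R) {z : ℂ} (hz : R < ‖z‖) (hz0 : z ≠ 0) :
    z ∉ contourInterior γ a b := by
  rintro ⟨-, hb⟩
  have hsub : (fun t : ℝ => (t : ℂ) * z) '' Ici 1 ⊆ connectedComponentIn (γ '' Icc a b)ᶜ z := by
    refine IsPreconnected.subset_connectedComponentIn ?_ ⟨1, self_mem_Ici, by simp⟩ ?_
    · exact isPreconnected_Ici.image _ (by fun_prop)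
    · rintro _ ⟨t, ht, rfl⟩ ⟨s, hs, hst⟩
      have h1 := hR s hs
      rw [hst] at h1
      simp only [norm_mul, Complex.norm_real, Real.norm_eq_abs] at h1
      have h2 : (1 : ℝ) ≤ |t| := (mem_Ici.1 ht).trans (le_abs_self t)
      nlinarith [norm_nonneg z]
  obtain ⟨D, hD⟩ := (hb.subset hsub).exists_norm_le
  have hzp : 0 < ‖z‖ := norm_pos_iff.2 hz0
  have h := hD _ ⟨max 1 ((D + 1) / ‖z‖), mem_Ici.2 (le_max_left _ _), rfl⟩
  simp only [norm_mul, Complex.norm_real, Real.norm_eq_abs] at h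
  have h2 : (D + 1) / ‖z‖ ≤ |max 1 ((D + 1) / ‖z‖)| := (le_max_right _ _).trans (le_abs_self _)
  rw [div_le_iff₀ hzp] at h2
  linarith

/-! ### Dixon's proof of Cauchy's formula -/

/-- Symmetry makes the difference quotient regular in either variable with the other one fixed,
including on the diagonal. -/
theorem dslope_comm (F : ℂ → ℂ) (z w : ℂ) : dslope F z w = dslope F w z := by
  rcases eq_or_ne z w with rfl | h
  · rfl
  · rw [dslope_of_ne _ h.symm, dslope_of_ne _ h, slope_comm]

/-- Difference quotients of a holomorphic function with one argument in a compact set are locally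
bounded in the other argument. -/
theorem exists_bound_dslope {F : ℂ → ℂ} {Ω k : Set ℂ} (hΩ : IsOpen Ω)
    (hF : DifferentiableOn ℂ F Ω) (hk : IsCompact k) (hkΩ : k ⊆ Ω) {z₀ : ℂ} (hz₀ : z₀ ∈ Ω) :
    ∃ r > 0, ∃ C, Metric.ball z₀ r ⊆ Ω ∧ ∀ z ∈ Metric.ball z₀ r, ∀ w ∈ k, ‖dslope F w z‖ ≤ C := by
  obtain ⟨r, hr, hball⟩ := Metric.nhds_basis_closedBall.mem_iff.1 (hΩ.mem_nhds hz₀)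
  have hcpt := isCompact_closedBall z₀ r
  obtain ⟨C₁, hC₁⟩ := hcpt.exists_bound_of_continuousOn
    ((hF.deriv hΩ).continuousOn.mono hball)
  obtain ⟨C₂, hC₂⟩ := hcpt.exists_bound_of_continuousOn (hF.continuousOn.mono hball)
  obtain ⟨C₃, hC₃⟩ := hk.exists_bound_of_continuousOn (hF.continuousOn.mono hkΩ)
  have hrr : Metric.ball z₀ (r / 2) ⊆ Metric.closedBall z₀ r :=
    (Metric.ball_subset_ball (by linarith)).trans Metric.ball_subset_closedBall
  refine ⟨r / 2, half_pos hr, max C₁ ((C₂ + C₃) / (r / 2)), hrr.trans hball, ?_⟩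
  intro z hz w hw
  rcases eq_or_ne z w with rfl | hne
  · rw [dslope_same]
    exact (hC₁ z (hrr hz)).trans (le_max_left _ _)
  have hpos : 0 < ‖z - w‖ := norm_pos_iff.2 (sub_ne_zero.2 hne)
  rw [dslope_of_ne _ hne, slope_def_field, norm_div]
  -- For w in the ball the mean value inequality applies; otherwise the denominator is at least r/2.
  by_cases hwb : w ∈ Metric.closedBall z₀ r
  · refine le_trans ?_ (le_max_left _ _)
    rw [div_le_iff₀ hpos]
    exact (convex_closedBall z₀ r).norm_image_sub_le_of_norm_deriv_le
      (fun y hy => hF.differentiableAt (hΩ.mem_nhds (hball hy))) hC₁ hwb (hrr hz)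
  · refine le_trans ?_ (le_max_right _ _)
    have h1 : ‖F z - F w‖ ≤ C₂ + C₃ :=
      (norm_sub_le _ _).trans (add_le_add (hC₂ z (hrr hz)) (hC₃ w hw))
    refine div_le_div₀ ((norm_nonneg _).trans h1) h1 (half_pos hr) ?_
    rw [Metric.mem_closedBall, not_le] at hwb
    rw [Metric.mem_ball] at hz
    rw [← dist_eq_norm]
    linarith [dist_triangle w z z₀, dist_comm z w]

theorem IsRectifiableLoop.contourIntegral_dslope {γ : ℝ → ℂ} {a b : ℝ}
    (hγ : IsRectifiableLoop γ a b) {F : ℂ → ℂ} (hF : ContinuousOn F (γ '' Icc a b)) {z : ℂ}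
    (hz : z ∉ γ '' Icc a b) :
    contourIntegral γ a b (fun ζ => dslope F ζ z) =
      contourIntegral γ a b (fun ζ => F ζ / (ζ - z)) -
        F z * contourIntegral γ a b (fun ζ => 1 / (ζ - z)) := by
  have hne : ∀ ζ ∈ γ '' Icc a b, ζ - z ≠ 0 := fun ζ hζ h => hz (by
    rwa [← sub_eq_zero.1 h])
  have hsub : ContinuousOn (fun ζ => ζ - z) (γ '' Icc a b) := by fun_prop
  have h1 : ContourIntegrable γ a b (fun ζ => F ζ / (ζ - z)) :=
    hγ.contourIntegrable (hF.div hsub hne)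
  have h2 : ContourIntegrable γ a b (fun ζ => 1 / (ζ - z)) :=
    hγ.contourIntegrable (continuousOn_const.div hsub hne)
  unfold contourIntegral
  rw [← intervalIntegral.integral_const_mul, ← intervalIntegral.integral_sub h1 (h2.const_mul _)]
  refine intervalIntegral.integral_congr fun t ht => ?_
  rw [uIcc_of_le hγ.lt.le] at ht
  have h3 := hne _ ⟨t, ht, rfl⟩
  simp only
  rw [dslope_comm, dslope_of_ne _ (sub_ne_zero.1 h3), slope_def_field]
  field_simp

open Classical in
/-- Dixon's form of Cauchy's theorem. -/
theorem IsRectifiableLoop.contourIntegral_dslope_eq_zero {γ : ℝ → ℂ} {a b : ℝ}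
    (hγ : IsRectifiableLoop γ a b) {F : ℂ → ℂ} {Ω : Set ℂ} (hΩ : IsOpen Ω)
    (hF : DifferentiableOn ℂ F Ω) (hγΩ : γ '' Icc a b ⊆ Ω) (hint : contourInterior γ a b ⊆ Ω)
    {z : ℂ} (hz : z ∈ Ω) : contourIntegral γ a b (fun ζ => dslope F ζ z) = 0 := by
  have hFc : ContinuousOn F (γ '' Icc a b) := hF.continuousOn.mono hγΩ
  set T : ℂ → ℂ := fun z => contourIntegral γ a b (fun ζ => F ζ / (ζ - z)) with hT
  -- The two formulas agree wherever the winding number vanishes, so H is entire; it tends to 0 at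
  -- infinity, hence is identically 0 by Liouville.
  set H : ℂ → ℂ := fun z =>
    if z ∈ Ω then contourIntegral γ a b (fun ζ => dslope F ζ z) else T z with hH
  have hHT : ∀ z, z ∉ γ '' Icc a b → z ∉ contourInterior γ a b → H z = T z := by
    intro z h1 h2
    by_cases hz : z ∈ Ω
    · simp only [hH, hz, if_true, hT]
      rw [hγ.contourIntegral_dslope hFc h1, hγ.contourIntegral_inv_eq_zero h1 h2, mul_zero,
        sub_zero]
    · simp only [hH, hz, if_false]
  have hdiff : Differentiable ℂ H := by
    intro z
    by_cases hz : z ∈ Ω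
    · have hev : H =ᶠ[𝓝 z] fun z => contourIntegral γ a b (fun ζ => dslope F ζ z) := by
        filter_upwards [hΩ.mem_nhds hz] with y hy
        simp only [hH, hy, if_true]
      obtain ⟨r, hr, C, hball, hC⟩ := exists_bound_dslope hΩ hF hγ.isCompact_image hγΩ hz
      refine DifferentiableAt.congr_of_eventuallyEq ?_ hev
      refine (hasDerivAt_intervalIntegral_of_holomorphic
        (K := fun z t => dslope F (γ t) z) hγ.lt.le hγ.integrable hr (C := C)
        (fun t ht => ?_) (fun t ht y hy => hC y hy _ ⟨t, ht, rfl⟩) fun y hy => ?_).differentiableAt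
      · exact ((Complex.differentiableOn_dslope
          (hΩ.mem_nhds (hγΩ ⟨t, ht, rfl⟩))).2 hF).mono hball
      · simp only [dslope_comm F _ y]
        exact ((Complex.differentiableOn_dslope
          (hΩ.mem_nhds (hball hy))).2 hF).continuousOn.comp hγ.continuousOn
          fun t ht => hγΩ ⟨t, ht, rfl⟩
    · have h1 : z ∉ γ '' Icc a b := fun h => hz (hγΩ h)
      have h2 : z ∉ contourInterior γ a b := fun h => hz (hint h)
      -- The whole component of a point outside Ω is exterior to the loop, so H = T near that point
      -- even where the component meets Ω.
      have hVo : IsOpen (connectedComponentIn (γ '' Icc a b)ᶜ z) :=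
        hγ.isCompact_image.isClosed.isOpen_compl.connectedComponentIn
      have hev : H =ᶠ[𝓝 z] T := by
        filter_upwards [hVo.mem_nhds (mem_connectedComponentIn h1)] with y hy
        refine hHT y (connectedComponentIn_subset _ _ hy) fun h => h2 ⟨h1, ?_⟩
        rw [connectedComponentIn_eq hy]
        exact h.2
      exact (hγ.hasDerivAt_cauchyTransform hFc h1).differentiableAt.congr_of_eventuallyEq hev
  have hlim : Tendsto H (Bornology.cobounded ℂ) (𝓝 0) := by
    obtain ⟨R, hR⟩ := hγ.isCompact_image.isBounded.exists_norm_le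
    refine (hγ.tendsto_cauchyTransform hFc).congr' ?_
    filter_upwards [tendsto_norm_cobounded_atTop.eventually_gt_atTop R,
      tendsto_norm_cobounded_atTop.eventually_gt_atTop 0] with z hz hz0
    refine (hHT z (fun h => (hR z h).not_gt hz) ?_).symm
    exact notMem_contourInterior_of_norm_gt (fun t ht => hR _ ⟨t, ht, rfl⟩) hz (norm_pos_iff.1 hz0)
  rw [Metric.cobounded_eq_cocompact] at hlim
  have h0 := congrFun (hdiff.eq_const_of_tendsto_cocompact hlim) z
  simpa only [hH, hz, if_true, Function.const_apply] using h0

theorem IsRectifiableLoop.isOpen_contourInterior {γ : ℝ → ℂ} {a b : ℝ}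
    (hγ : IsRectifiableLoop γ a b) : IsOpen (contourInterior γ a b) := by
  refine isOpen_iff_mem_nhds.2 fun z hz => ?_
  have hVo : IsOpen (connectedComponentIn (γ '' Icc a b)ᶜ z) :=
    hγ.isCompact_image.isClosed.isOpen_compl.connectedComponentIn
  filter_upwards [hVo.mem_nhds (mem_connectedComponentIn hz.1)] with y hy
  refine ⟨connectedComponentIn_subset _ _ hy, ?_⟩
  rw [← connectedComponentIn_eq hy]
  exact hz.2

/-- Cauchy's integral formula for the derivative. -/
theorem IsRectifiableLoop.contourIntegral_div_sq {γ : ℝ → ℂ} {a b : ℝ}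
    (hγ : IsRectifiableLoop γ a b) (hpos : PositivelyOriented γ a b) {F : ℂ → ℂ} {Ω : Set ℂ}
    (hΩ : IsOpen Ω) (hF : DifferentiableOn ℂ F Ω) (hγΩ : γ '' Icc a b ⊆ Ω)
    (hint : contourInterior γ a b ⊆ Ω) {z : ℂ} (hz : z ∈ contourInterior γ a b) :
    contourIntegral γ a b (fun ζ => F ζ / (ζ - z) ^ 2) =
      2 * Real.pi * Complex.I * deriv F z := by
  have hFc : ContinuousOn F (γ '' Icc a b) := hF.continuousOn.mono hγΩ
  -- This is Cauchy's integral formula on the open interior; differentiating both sides gives the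
  -- claim.
  have hev : (fun z => contourIntegral γ a b (fun ζ => F ζ / (ζ - z))) =ᶠ[𝓝 z]
      fun z => 2 * Real.pi * Complex.I * F z := by
    filter_upwards [hγ.isOpen_contourInterior.mem_nhds hz] with y hy
    have h1 := hγ.contourIntegral_dslope_eq_zero hΩ hF hγΩ hint (hint hy)
    rw [hγ.contourIntegral_dslope hFc hy.1] at h1
    have h2 := hpos y hy
    rw [inv_mul_eq_iff_eq_mul₀ Complex.two_pi_I_ne_zero, mul_one] at h2
    rw [h2] at h1
    rw [sub_eq_zero.1 h1, mul_comm]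
  have h3 := ((hγ.hasDerivAt_cauchyTransform hFc hz.1).congr_of_eventuallyEq hev.symm).unique
    ((hF.differentiableAt (hΩ.mem_nhds (hint hz))).hasDerivAt.const_mul _)
  exact h3

/-! ### Sup-norm bounds for Fréchet integrals -/

theorem exists_sign_mul_eq_abs (x : ℕ → ℝ) :
    ∃ σ : ℕ → ℝ, (∀ i, σ i = 1 ∨ σ i = -1) ∧ ∀ i, σ i * x i = |x i| := by
  refine ⟨fun i => if 0 ≤ x i then 1 else -1, fun i => ?_, fun i => ?_⟩
  · by_cases h : 0 ≤ x i <;> simp [h]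
  · by_cases h : 0 ≤ x i
    · simp [h, abs_of_nonneg h]
    · simp [h, abs_of_neg (not_le.1 h)]

/-- A bilinear form that is bounded by `B` on sign vectors is bounded by `B` on the unit cube. -/
theorem abs_bilinear_sum_le {α : ℕ → ℕ → ℝ} {m n : ℕ} {B H K : ℝ}
    (hB : ∀ σ θ : ℕ → ℝ, (∀ i, σ i = 1 ∨ σ i = -1) → (∀ j, θ j = 1 ∨ θ j = -1) →
      |∑ i ∈ Finset.range m, ∑ j ∈ Finset.range n, σ i * θ j * α i j| ≤ B)
    (hH : 0 ≤ H) (hK : 0 ≤ K) {c d : ℕ → ℝ} (hc : ∀ i < m, |c i| ≤ H) (hd : ∀ j < n, |d j| ≤ K) :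
    |∑ i ∈ Finset.range m, ∑ j ∈ Finset.range n, c i * d j * α i j| ≤ H * (K * B) := by
  have step : ∀ (N : ℕ) (e x : ℕ → ℝ) (E : ℝ), (∀ i < N, |e i| ≤ E) →
      |∑ i ∈ Finset.range N, e i * x i| ≤ E * ∑ i ∈ Finset.range N, |x i| := by
    intro N e x E he
    rw [Finset.mul_sum]
    refine (Finset.abs_sum_le_sum_abs _ _).trans (Finset.sum_le_sum fun i hi => ?_)
    rw [abs_mul]
    exact mul_le_mul_of_nonneg_right (he i (Finset.mem_range.1 hi)) (abs_nonneg _)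
  -- The coefficients are replaced by signs one variable at a time: σ absorbs the inner sums over j,
  -- then θ those over i.
  obtain ⟨σ, hσ, hσx⟩ := exists_sign_mul_eq_abs fun i => ∑ j ∈ Finset.range n, d j * α i j
  obtain ⟨θ, hθ, hθx⟩ := exists_sign_mul_eq_abs fun j => ∑ i ∈ Finset.range m, σ i * α i j
  calc |∑ i ∈ Finset.range m, ∑ j ∈ Finset.range n, c i * d j * α i j|
      = |∑ i ∈ Finset.range m, c i * ∑ j ∈ Finset.range n, d j * α i j| := by
        simp only [Finset.mul_sum, mul_assoc]
    _ ≤ H * ∑ i ∈ Finset.range m, |∑ j ∈ Finset.range n, d j * α i j| := step _ _ _ _ hc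
    _ = H * ∑ j ∈ Finset.range n, d j * ∑ i ∈ Finset.range m, σ i * α i j := by
        congr 1
        simp only [← hσx, Finset.mul_sum]
        rw [Finset.sum_comm]
        exact Finset.sum_congr rfl fun j _ => Finset.sum_congr rfl fun i _ => by ring
    _ ≤ H * (K * ∑ j ∈ Finset.range n, |∑ i ∈ Finset.range m, σ i * α i j|) :=
        mul_le_mul_of_nonneg_left ((le_abs_self _).trans (step _ _ _ _ hd)) hH
    _ = H * (K * ∑ i ∈ Finset.range m, ∑ j ∈ Finset.range n, σ i * θ j * α i j) := by
        congr 2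
        simp only [← hθx, Finset.mul_sum]
        rw [Finset.sum_comm]
        exact Finset.sum_congr rfl fun j _ => Finset.sum_congr rfl fun i _ => by ring
    _ ≤ H * (K * B) := mul_le_mul_of_nonneg_left
        (mul_le_mul_of_nonneg_left ((le_abs_self _).trans (hB σ θ hσ hθ)) hK) hH

/-- The factor 4 counts the real forms obtained from the real and imaginary parts of c and d. -/
theorem norm_bilinear_sum_le {α : ℕ → ℕ → ℝ} {m n : ℕ} {B H K : ℝ}
    (hB : ∀ σ θ : ℕ → ℝ, (∀ i, σ i = 1 ∨ σ i = -1) → (∀ j, θ j = 1 ∨ θ j = -1) →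
      |∑ i ∈ Finset.range m, ∑ j ∈ Finset.range n, σ i * θ j * α i j| ≤ B)
    (hH : 0 ≤ H) (hK : 0 ≤ K) {c d : ℕ → ℂ} (hc : ∀ i < m, ‖c i‖ ≤ H) (hd : ∀ j < n, ‖d j‖ ≤ K) :
    ‖∑ i ∈ Finset.range m, ∑ j ∈ Finset.range n, c i * d j * (α i j : ℂ)‖ ≤ 4 * B * H * K := by
  have hcr : ∀ i < m, |(c i).re| ≤ H := fun i hi => (Complex.abs_re_le_norm _).trans (hc i hi)
  have hci : ∀ i < m, |(c i).im| ≤ H := fun i hi => (Complex.abs_im_le_norm _).trans (hc i hi)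
  have hdr : ∀ i < n, |(d i).re| ≤ K := fun i hi => (Complex.abs_re_le_norm _).trans (hd i hi)
  have hdi : ∀ i < n, |(d i).im| ≤ K := fun i hi => (Complex.abs_im_le_norm _).trans (hd i hi)
  have h1 := abs_le.1 (abs_bilinear_sum_le hB hH hK hcr hdr)
  have h2 := abs_le.1 (abs_bilinear_sum_le hB hH hK hci hdi)
  have h3 := abs_le.1 (abs_bilinear_sum_le hB hH hK hcr hdi)
  have h4 := abs_le.1 (abs_bilinear_sum_le hB hH hK hci hdr)
  refine (Complex.norm_le_abs_re_add_abs_im _).trans ?_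
  have hre : (∑ i ∈ Finset.range m, ∑ j ∈ Finset.range n, c i * d j * (α i j : ℂ)).re =
      (∑ i ∈ Finset.range m, ∑ j ∈ Finset.range n, (c i).re * (d j).re * α i j) -
        ∑ i ∈ Finset.range m, ∑ j ∈ Finset.range n, (c i).im * (d j).im * α i j := by
    simp only [Complex.re_sum, ← Finset.sum_sub_distrib]
    refine Finset.sum_congr rfl fun i _ => Finset.sum_congr rfl fun j _ => ?_
    simp
    ring
  have him : (∑ i ∈ Finset.range m, ∑ j ∈ Finset.range n, c i * d j * (α i j : ℂ)).im =
      (∑ i ∈ Finset.range m, ∑ j ∈ Finset.range n, (c i).re * (d j).im * α i j) +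
        ∑ i ∈ Finset.range m, ∑ j ∈ Finset.range n, (c i).im * (d j).re * α i j := by
    simp only [Complex.im_sum, ← Finset.sum_add_distrib]
    refine Finset.sum_congr rfl fun i _ => Finset.sum_congr rfl fun j _ => ?_
    simp
    ring
  have hRe : |(∑ i ∈ Finset.range m, ∑ j ∈ Finset.range n, c i * d j * (α i j : ℂ)).re| ≤
      2 * (H * (K * B)) := by
    rw [hre, abs_le]
    constructor <;> linarith [h1.1, h1.2, h2.1, h2.2]
  have hIm : |(∑ i ∈ Finset.range m, ∑ j ∈ Finset.range n, c i * d j * (α i j : ℂ)).im| ≤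
      2 * (H * (K * B)) := by
    rw [him, abs_le]
    constructor <;> linarith [h3.1, h3.2, h4.1, h4.2]
  linarith

theorem exists_fine_partition {M δ : ℝ} (hM : 0 < M) (hδ : 0 < δ) :
    ∃ (n : ℕ) (s : ℕ → ℝ), IsPartition M n s ∧ (∀ i < n, s (i + 1) - s i < δ) ∧
      ∀ i < n, s i ∈ Icc (-M) M := by
  obtain ⟨n, hn⟩ := exists_nat_gt (2 * M / δ)
  have hn0 : (0 : ℝ) < n := lt_trans (by positivity) hn
  have hstep : ∀ i : ℕ, (-M + (i + 1 : ℕ) * (2 * M / n)) - (-M + i * (2 * M / n)) = 2 * M / n := by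
    intro i
    push_cast
    ring
  have hpos : 0 < 2 * M / n := by positivity
  refine ⟨n, fun i => -M + i * (2 * M / n), ⟨by simp, ?_, fun i _ => ?_⟩, fun i _ => ?_,
    fun i hi => ⟨?_, ?_⟩⟩
  · field_simp
    ring
  · linarith [hstep i]
  · rw [hstep i, div_lt_iff₀ hn0]
    rw [div_lt_iff₀ hδ] at hn
    linarith
  · have : 0 ≤ (i : ℝ) * (2 * M / n) := by positivity
    linarith
  · have h1 : (i : ℝ) * (2 * M / n) ≤ n * (2 * M / n) :=
      mul_le_mul_of_nonneg_right (by exact_mod_cast hi.le) hpos.le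
    have h2 : (n : ℝ) * (2 * M / n) = 2 * M := by field_simp
    linarith

/-- Fréchet integrals against a function of bounded Fréchet variation are continuous in the
supremum norms of the integrands. -/
theorem HasFrechetIntegral.norm_le {M B : ℝ} (hM : 0 < M) {u : ℝ → ℝ → ℝ}
    (hB : ∀ (m n : ℕ) (s t σ θ : ℕ → ℝ), IsPartition M m s → IsPartition M n t →
      (∀ i, σ i = 1 ∨ σ i = -1) → (∀ j, θ j = 1 ∨ θ j = -1) →
      |∑ i ∈ Finset.range m, ∑ j ∈ Finset.range n,
        σ i * θ j * rectIncr u (s i) (s (i + 1)) (t j) (t (j + 1))| ≤ B)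
    {f g : ℝ → ℂ} {I : ℂ} (h : HasFrechetIntegral M u f g I) {H K : ℝ} (hH : 0 ≤ H) (hK : 0 ≤ K)
    (hf : ∀ x ∈ Icc (-M) M, ‖f x‖ ≤ H) (hg : ∀ x ∈ Icc (-M) M, ‖g x‖ ≤ K) :
    ‖I‖ ≤ 4 * B * H * K := by
  refine le_of_forall_pos_le_add fun ε hε => ?_
  obtain ⟨δ, hδ, hsum⟩ := h ε hε
  -- A single fine Riemann sum, with left endpoints as tags, is within ε of the integral and obeys
  -- the uniform bound.
  obtain ⟨n, s, hs, hmesh, hmem⟩ := exists_fine_partition hM hδ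
  have htag : ∀ i < n, s i ∈ Icc (s i) (s (i + 1)) := fun i hi => ⟨le_rfl, hs.2.2 i hi⟩
  have h1 := hsum n n s s s s hs hs hmesh hmesh htag htag
  have h2 := norm_bilinear_sum_le (fun σ θ hσ hθ => hB n n s s σ θ hs hs hσ hθ) hH hK
    (c := fun i => f (s i)) (d := fun j => g (s j)) (fun i hi => hf _ (hmem i hi))
    (fun i hi => hg _ (hmem i hi))
  rw [norm_sub_rev] at h1
  linarith [norm_sub_norm_le I (∑ i ∈ Finset.range n, ∑ j ∈ Finset.range n,
    f (s i) * g (s j) * (rectIncr u (s i) (s (i + 1)) (s j) (s (j + 1)) : ℂ))]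

/-! ### Antiderivatives and the bounded form β -/

/-- Extending h by its endpoint values keeps it continuous, so its antiderivative is C¹ on all of ℝ,
as membership in `C1 M` requires. -/
theorem hasDerivAt_integral_IccExtend {M : ℝ} (hM : -M ≤ M) (h : C(Icc (-M) M, ℂ)) (x : ℝ) :
    HasDerivAt (fun x => ∫ s in (0 : ℝ)..x, IccExtend hM h s) (IccExtend hM h x) x := by
  have hc : Continuous (IccExtend hM h) := h.continuous.Icc_extend'
  exact intervalIntegral.integral_hasDerivAt_right (hc.intervalIntegrable _ _)
    (hc.stronglyMeasurableAtFilter _ _) hc.continuousAt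

theorem contDiff_integral_IccExtend {M : ℝ} (hM : -M ≤ M) (h : C(Icc (-M) M, ℂ)) :
    ContDiff ℝ 1 (fun x => ∫ s in (0 : ℝ)..x, IccExtend hM h s) := by
  refine contDiff_one_iff_deriv.2
    ⟨fun x => (hasDerivAt_integral_IccExtend hM h x).differentiableAt, ?_⟩
  rw [funext fun x => (hasDerivAt_integral_IccExtend hM h x).deriv]
  exact h.continuous.Icc_extend'

/-- The antiderivative that vanishes at `0`, as a linear map `C([-M, M]) → C¹([-M, M])`. -/
noncomputable def antiderivative {M : ℝ} (hM : -M ≤ M) : C(Icc (-M) M, ℂ) →ₗ[ℂ] C1 M where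
  toFun h := ⟨fun x => ∫ s in (0 : ℝ)..x, IccExtend hM h s,
    ⟨_, contDiff_integral_IccExtend hM h, fun _ => rfl⟩⟩
  map_add' h k := by
    ext x
    exact intervalIntegral.integral_add (h.continuous.Icc_extend'.intervalIntegrable _ _)
      (k.continuous.Icc_extend'.intervalIntegrable _ _)
  map_smul' c h := by
    ext x
    exact intervalIntegral.integral_smul c _

theorem derivative_antiderivative {M : ℝ} (hM : 0 < M) (h : C(Icc (-M) M, ℂ)) (x : ℝ)
    (hx : x ∈ Icc (-M) M) :
    C1.derivative (antiderivative (by linarith) h) x = h ⟨x, hx⟩ := by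
  have hM' : -M ≤ M := by linarith
  rw [C1.derivative_eq hM _ _ (contDiff_integral_IccExtend hM' h) (fun _ => rfl) x hx,
    (hasDerivAt_integral_IccExtend hM' h x).deriv, IccExtend_of_mem _ _ hx]

/-- A `C¹` function differs from the antiderivative of its derivative by a constant. -/
theorem exists_eq_antiderivative_add {M : ℝ} (hM : 0 < M) (f : C1 M) (h : C(Icc (-M) M, ℂ))
    (hfh : ∀ x : Icc (-M) M, C1.derivative f x = h x) :
    ∃ c : ℂ, f = antiderivative (by linarith) h + c • (1 : C1 M) := by
  obtain ⟨F, hF, hFf⟩ := f.2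
  have hM' : -M ≤ M := by linarith
  -- The antiderivative is normalised at 0, which lies in [-M, M].
  refine ⟨F 0, ?_⟩
  ext x
  have h1 : ∫ s in (0 : ℝ)..x, deriv F s = F x - F 0 :=
    intervalIntegral.integral_deriv_eq_sub (fun y _ => hF.differentiable one_ne_zero y)
      ((hF.continuous_deriv le_rfl).intervalIntegrable _ _)
  have h2 : ∫ s in (0 : ℝ)..x, deriv F s = ∫ s in (0 : ℝ)..x, IccExtend hM' h s := by
    refine intervalIntegral.integral_congr fun s hs => ?_
    have hs' : s ∈ Icc (-M) M := uIcc_subset_Icc ⟨by linarith, hM.le⟩ x.2 hs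
    rw [IccExtend_of_mem _ _ hs', ← C1.derivative_eq hM f F hF hFf s hs', hfh ⟨s, hs'⟩]
  have h3 : ((antiderivative hM' h + F 0 • (1 : C1 M) : C1 M) : Icc (-M) M → ℂ) x =
      (∫ s in (0 : ℝ)..x, IccExtend hM' h s) + F 0 * 1 := rfl
  rw [h3, ← h2, h1, ← hFf x]
  ring

/-- The functional `ρ` of an analytic second-order probability space factors through a bounded
bilinear form of the derivatives. -/
theorem SecondOrderNCPS.IsAnalytic.exists_bilinear {M : ℝ} (hM : 0 < M)
    {S : SecondOrderNCPS (C1 M)} (hS : S.IsAnalytic) :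
    ∃ β : C(Icc (-M) M, ℂ) →L[ℂ] C(Icc (-M) M, ℂ) →L[ℂ] ℂ,
      ∀ (f g : C1 M) (h k : C(Icc (-M) M, ℂ)), (∀ x : Icc (-M) M, C1.derivative f x = h x) →
        (∀ x : Icc (-M) M, C1.derivative g x = k x) → S.ρ f g = β h k := by
  obtain ⟨-, u, ⟨B, hB⟩, hu⟩ := hS
  have hM' : -M ≤ M := by linarith
  -- β is ρ pulled back along antiderivatives; the bound 4B is that of `HasFrechetIntegral.norm_le`.
  refine ⟨(S.ρ.compl₁₂ (antiderivative hM') (antiderivative hM')).mkContinuous₂ (4 * B)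
    fun h k => ?_, fun f g h k hf hg => ?_⟩
  · refine (hu (antiderivative hM' h) (antiderivative hM' k)).norm_le hM hB (norm_nonneg h)
      (norm_nonneg k) (fun x hx => ?_) fun x hx => ?_
    · rw [derivative_antiderivative hM h x hx]
      exact h.norm_coe_le_norm _
    · rw [derivative_antiderivative hM k x hx]
      exact k.norm_coe_le_norm _
  · obtain ⟨c, hc⟩ := exists_eq_antiderivative_add hM f h hf
    obtain ⟨d, hd⟩ := exists_eq_antiderivative_add hM g k hg
    rw [hc, hd]
    simp only [map_add, map_smul, LinearMap.add_apply, LinearMap.smul_apply, S.ρ_one_left,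
      S.ρ_one_right, smul_zero, add_zero]
    rfl

/-! ### Derivatives of resolvents and of holomorphic functions -/

/-- Differentiability at the single point x is enough. This suits r_z with z real, and holomorphic
F, whose formulas need not be smooth on all of ℝ. -/
theorem C1.derivative_eq_of_hasDerivAt {M : ℝ} (hM : 0 < M) {f : C1 M} {P : ℝ → ℂ}
    (hP : ∀ x : Icc (-M) M, P x = f.1 x) {x : ℝ} (hx : x ∈ Icc (-M) M) {d : ℂ}
    (hd : HasDerivAt P d x) : C1.derivative f x = d := by
  have key : ∀ y ∈ Icc (-M) M, Function.extend Subtype.val f.1 0 y = P y := fun y hy => by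
    rw [hP ⟨y, hy⟩]
    exact Subtype.val_injective.extend_apply f.1 0 ⟨y, hy⟩
  unfold C1.derivative
  rw [derivWithin_congr key (key x hx)]
  exact hd.hasDerivWithinAt.derivWithin (uniqueDiffOn_Icc (by linarith) x hx)

/-- The derivative `x ↦ 1 / (z - x)²` of the resolvent `r_z`, for `z ∉ [-M, M]`. -/
noncomputable def resolventDeriv (M : ℝ) (z : ℂ) : C(Icc (-M) M, ℂ) :=
  ContinuousMap.mkD (fun x => 1 / (z - ((x : ℝ) : ℂ)) ^ 2) 0

theorem sub_ne_zero_of_notMem_realSegment {M : ℝ} {z : ℂ} (hz : z ∉ realSegment M)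
    (x : Icc (-M) M) : z - ((x : ℝ) : ℂ) ≠ 0 := fun h => hz ⟨x, x.2, (sub_eq_zero.1 h).symm⟩

theorem resolventDeriv_apply {M : ℝ} {z : ℂ} (hz : z ∉ realSegment M) (x : Icc (-M) M) :
    resolventDeriv M z x = 1 / (z - ((x : ℝ) : ℂ)) ^ 2 :=
  ContinuousMap.mkD_apply_of_continuous (continuous_const.div (by fun_prop)
    fun x => pow_ne_zero 2 (sub_ne_zero_of_notMem_realSegment hz x))

/-- Joint continuity in (z, x) with x in a compact set gives continuity of z into the sup norm,
hence integrability along the contour. -/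
theorem continuousOn_resolventDeriv (M : ℝ) :
    ContinuousOn (resolventDeriv M) (realSegment M)ᶜ := by
  refine ContinuousMap.continuousOn_mkD_of_uncurry
    (fun (z : ℂ) (x : Icc (-M) M) => 1 / (z - ((x : ℝ) : ℂ)) ^ 2) 0 ?_
  refine continuousOn_const.div (by fun_prop) ?_
  rintro ⟨z, x⟩ ⟨hz, -⟩
  exact pow_ne_zero 2 (sub_ne_zero_of_notMem_realSegment hz x)

theorem derivative_resolventC1 {M : ℝ} (hM : 0 < M) {z : ℂ} (hz : z ∉ realSegment M)
    (x : Icc (-M) M) : C1.derivative (resolventC1 M z) x = resolventDeriv M z x := by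
  rw [resolventDeriv_apply hz]
  refine C1.derivative_eq_of_hasDerivAt hM (P := fun y : ℝ => 1 / (z - (y : ℂ))) ?_ x.2 ?_
  · intro y
    simp [resolventC1, hz]
  · simpa using (((hasDerivAt_id ((x : ℝ) : ℂ)).const_sub z).fun_inv
      (sub_ne_zero_of_notMem_realSegment hz x)).comp_ofReal

/-- A holomorphic function on an open neighbourhood of `[-M, M]` has a continuous derivative
there. -/
theorem continuous_deriv_comp_ofReal {M : ℝ} {Ω : Set ℂ} (hΩ : IsOpen Ω)
    (hΩM : realSegment M ⊆ Ω) {F : ℂ → ℂ} (hF : DifferentiableOn ℂ F Ω) :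
    Continuous (fun x : Icc (-M) M => deriv F ((x : ℝ) : ℂ)) :=
  (hF.deriv hΩ).continuousOn.comp_continuous (by fun_prop) fun x => hΩM ⟨x, x.2, rfl⟩

theorem derivative_eq_deriv_of_holomorphic {M : ℝ} (hM : 0 < M) {Ω : Set ℂ} (hΩ : IsOpen Ω)
    (hΩM : realSegment M ⊆ Ω) {F : ℂ → ℂ} (hF : DifferentiableOn ℂ F Ω) {f : C1 M}
    (hFf : ∀ x : Icc (-M) M, F ((x : ℝ) : ℂ) = f.1 x) (x : Icc (-M) M) :
    C1.derivative f x = deriv F ((x : ℝ) : ℂ) :=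
  C1.derivative_eq_of_hasDerivAt hM (P := fun y : ℝ => F (y : ℂ)) hFf x.2
    (hF.differentiableAt (hΩ.mem_nhds (hΩM ⟨x, x.2, rfl⟩))).hasDerivAt.comp_ofReal

/-! ### Cauchy's formula in C([-M, M]) and the conclusion -/

/-- Cauchy's formula for the derivative on `[-M, M]`, tested against a bounded functional. -/
theorem contourIntegral_mul_resolventDeriv {M : ℝ} {γ : ℝ → ℂ} {a b : ℝ}
    (hγ : IsRectifiableLoop γ a b) (hpos : PositivelyOriented γ a b) {F : ℂ → ℂ} {Ω : Set ℂ}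
    (hΩ : IsOpen Ω) (hF : DifferentiableOn ℂ F Ω) (hγΩ : γ '' Icc a b ⊆ Ω)
    (hint : contourInterior γ a b ⊆ Ω) (henc : realSegment M ⊆ contourInterior γ a b)
    (h : C(Icc (-M) M, ℂ)) (hh : ∀ x : Icc (-M) M, h x = deriv F ((x : ℝ) : ℂ))
    (ℓ : C(Icc (-M) M, ℂ) →L[ℂ] ℂ) :
    ContourIntegrable γ a b (fun z => F z * ℓ (resolventDeriv M z)) ∧
      contourIntegral γ a b (fun z => F z * ℓ (resolventDeriv M z)) =
        2 * Real.pi * Complex.I * ℓ h := by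
  have hseg : γ '' Icc a b ⊆ (realSegment M)ᶜ := fun z hz hz' => (henc hz').1 hz
  have hFc : ContinuousOn F (γ '' Icc a b) := hF.continuousOn.mono hγΩ
  have hR : ContinuousOn (resolventDeriv M) (γ '' Icc a b) :=
    (continuousOn_resolventDeriv M).mono hseg
  refine ⟨hγ.contourIntegrable (hFc.mul (ℓ.continuous.comp_continuousOn hR)), ?_⟩
  set Φ : ℝ → C(Icc (-M) M, ℂ) := fun t => deriv γ t • (F (γ t) • resolventDeriv M (γ t))
  have hΦ : IntervalIntegrable Φ volume a b := by
    refine hγ.integrable.smul_continuousOn ?_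
    rw [uIcc_of_le hγ.lt.le]
    exact (hFc.smul hR).comp hγ.continuousOn (mapsTo_image _ _)
  -- The vector-valued identity is checked pointwise: evaluation at x is a bounded functional, and
  -- it reduces the claim to the scalar Cauchy formula.
  have hval : ∫ t in a..b, Φ t = (2 * Real.pi * Complex.I : ℂ) • h := by
    ext x
    have h1 := (ContinuousMap.evalCLM ℂ x).intervalIntegral_comp_comm hΦ
    simp only [ContinuousMap.evalCLM_apply] at h1
    rw [← h1, ContinuousMap.smul_apply, hh, smul_eq_mul,
      ← hγ.contourIntegral_div_sq hpos hΩ hF hγΩ hint (henc ⟨x, x.2, rfl⟩)]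
    refine intervalIntegral.integral_congr fun t ht => ?_
    rw [uIcc_of_le hγ.lt.le] at ht
    simp only [Φ, ContinuousMap.smul_apply, smul_eq_mul,
      resolventDeriv_apply (hseg ⟨t, ht, rfl⟩)]
    ring
  have h2 := ℓ.intervalIntegral_comp_comm hΦ
  rw [hval, map_smul, smul_eq_mul] at h2
  rw [← h2]
  refine intervalIntegral.integral_congr fun t _ => ?_
  simp only [Φ, map_smul, smul_eq_mul]
  ring

theorem contourIntegral_congr {γ : ℝ → ℂ} {a b : ℝ} (hab : a ≤ b) {F G : ℂ → ℂ}
    (h : EqOn F G (γ '' Icc a b)) : contourIntegral γ a b F = contourIntegral γ a b G := by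
  refine intervalIntegral.integral_congr fun t ht => ?_
  rw [uIcc_of_le hab] at ht
  simp only [h ⟨t, ht, rfl⟩]

theorem ContourIntegrable.congr {γ : ℝ → ℂ} {a b : ℝ} (hab : a ≤ b) {F G : ℂ → ℂ}
    (hF : ContourIntegrable γ a b F) (h : EqOn F G (γ '' Icc a b)) :
    ContourIntegrable γ a b G := by
  refine IntervalIntegrable.congr (fun t ht => ?_) hF
  rw [uIoc_of_le hab] at ht
  simp only [h ⟨t, Ioc_subset_Icc_self ht, rfl⟩]

theorem mainTheorem7 (M : ℝ) (hM : 0 < M) (S : SecondOrderNCPS (C1 M)) (hS : S.IsAnalytic)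
    (f g : C1 M) (Ω : Set ℂ) (hΩo : IsOpen Ω) (hΩc : IsConnected Ω)
    (hΩM : realSegment M ⊆ Ω)
    (F G : ℂ → ℂ) (hF : DifferentiableOn ℂ F Ω) (hG : DifferentiableOn ℂ G Ω)
    (hFf : ∀ x : Set.Icc (-M) M, F ((x : ℝ) : ℂ) = f.1 x)
    (hGg : ∀ x : Set.Icc (-M) M, G ((x : ℝ) : ℂ) = g.1 x)
    (γ : ℝ → ℂ) (a b : ℝ) (hγ : IsSimpleClosedContour γ a b) (hpos : PositivelyOriented γ a b)
    (hγΩ : γ '' Set.Icc a b ⊆ Ω) (hintΩ : contourInterior γ a b ⊆ Ω)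
    (henc : realSegment M ⊆ contourInterior γ a b) :
    (∀ w ∈ γ '' Set.Icc a b, ContourIntegrable γ a b (fun z => F z * G w * S.G₂ z w)) ∧
    ContourIntegrable γ a b
      (fun w => contourIntegral γ a b (fun z => F z * G w * S.G₂ z w)) ∧
    S.ρ f g = 1 / (2 * Real.pi * Complex.I) ^ 2 *
      contourIntegral γ a b
        (fun w => contourIntegral γ a b (fun z => F z * G w * S.G₂ z w)) := by
  have hloop := hγ.isRectifiableLoop
  obtain ⟨β, hβ⟩ := hS.exists_bilinear hM
  have hseg : ∀ z ∈ γ '' Icc a b, z ∉ realSegment M := fun z hz hz' => (henc hz').1 hz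
  set h : C(Icc (-M) M, ℂ) := ⟨_, continuous_deriv_comp_ofReal hΩo hΩM hF⟩
  set k : C(Icc (-M) M, ℂ) := ⟨_, continuous_deriv_comp_ofReal hΩo hΩM hG⟩
  have hG₂ : ∀ z ∈ γ '' Icc a b, ∀ w ∈ γ '' Icc a b,
      S.G₂ z w = β (resolventDeriv M z) (resolventDeriv M w) := fun z hz w hw =>
    hβ _ _ _ _ (derivative_resolventC1 hM (hseg z hz)) (derivative_resolventC1 hM (hseg w hw))
  -- With w fixed, the functional is G(w) β(·, (w - ·)⁻²); the inner integral is then 2πi G(w) β(f',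
  -- (w - ·)⁻²).
  have inner := fun w => contourIntegral_mul_resolventDeriv hloop hpos hΩo hF hγΩ hintΩ henc h
    (fun _ => rfl) (G w • β.flip (resolventDeriv M w))
  -- The outer integral applies the same lemma to 2πi β(f', ·), producing (2πi)² β(f', g').
  obtain ⟨outer_int, outer⟩ := contourIntegral_mul_resolventDeriv hloop hpos hΩo hG hγΩ hintΩ henc
    k (fun _ => rfl) ((2 * Real.pi * Complex.I : ℂ) • β h)
  have hcongr : ∀ w ∈ γ '' Icc a b,
      EqOn (fun z => F z * (G w • β.flip (resolventDeriv M w)) (resolventDeriv M z))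
        (fun z => F z * G w * S.G₂ z w) (γ '' Icc a b) := fun w hw z hz => by
    simp only [hG₂ z hz w hw, smul_apply, ContinuousLinearMap.flip_apply,
      smul_eq_mul, mul_assoc]
  have hinner : EqOn
      (fun w => G w * ((2 * Real.pi * Complex.I : ℂ) • β h) (resolventDeriv M w))
      (fun w => contourIntegral γ a b (fun z => F z * G w * S.G₂ z w)) (γ '' Icc a b) :=
    fun w hw => by
      simp only
      rw [← contourIntegral_congr hloop.lt.le (hcongr w hw), (inner w).2]
      simp only [smul_apply, ContinuousLinearMap.flip_apply, smul_eq_mul]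
      ring
  refine ⟨fun w hw => (inner w).1.congr hloop.lt.le (hcongr w hw),
    outer_int.congr hloop.lt.le hinner, ?_⟩
  rw [← contourIntegral_congr hloop.lt.le hinner, outer,
    hβ f g h k (derivative_eq_deriv_of_holomorphic hM hΩo hΩM hF hFf)
      (derivative_eq_deriv_of_holomorphic hM hΩo hΩM hG hGg)]
  have h2pi := Complex.two_pi_I_ne_zero
  simp only [smul_apply, smul_eq_mul]
  field_simp
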